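/- Let $R$ be an integral domain and let $R'$ be its integral closure in its field of fractions. An ideal of $R$ is \emph{stable} if it is projective as a module over its endomorphism ring. The domain $R$ is \emph{stable} (respectively, \emph{finitely stable}) if each nonzero (respectively, each nonzero finitely generated) ideal of $R$ is stable; $R$ has \emph{finite character} if each nonzero element of $R$ belongs to just finitely many maximal ideals of $R$; a domain $D$ is \emph{Archimedean} if $\bigcap_{n\ge 0} r^nD=(0)$ for each nonunit $r\in D$. (1) Let $R$ be finitely stable, and let $a$ be a nonzero nonunit of $R$ belonging to just finitely many maximal ideals of $R$. The following conditions are equivalent: (i) $\bigcap_{n\ge 1}a^nR=(0)$; (ii) $a$ belongs to a height-one prime ideal of $R'$; (iii) $a$ belongs to a prime ideal $P$ of $R$ such that the domain $R_P$ is Archimedean. (2) Let $R$ be a finitely stable domain of finite character. Then $R$ is Archimedean if and only if every nonzero nonunit of $R$ belongs to a height-one prime ideal of $R'$. (3) If $R$ is a stable domain, then $R$ is finitely stable and has finite character; in particular, (2) applies to every stable domain. -/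

import Mathlib

/-- An ideal `I` is stable if it is projective as a module over its endomorphism ring. -/
def IsStableIdeal {R : Type*} [CommRing R] (I : Ideal R) : Prop :=
  Module.Projective (Module.End R I) I

/-- A domain is stable if each nonzero ideal is stable. -/
def IsStableDomain (R : Type*) [CommRing R] [IsDomain R] : Prop :=
  ∀ I : Ideal R, I ≠ ⊥ → IsStableIdeal I

/-- A domain is finitely stable if each nonzero finitely generated ideal is stable. -/
def IsFinitelyStableDomain (R : Type*) [CommRing R] [IsDomain R] : Prop :=
  ∀ I : Ideal R, I.FG → I ≠ ⊥ → IsStableIdeal I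

/-- `a` belongs to just finitely many maximal ideals of `R`. -/
def InFinitelyManyMaximalIdeals {R : Type*} [CommRing R] (a : R) : Prop :=
  {M : Ideal R | M.IsMaximal ∧ a ∈ M}.Finite

/-- A domain has finite character if each nonzero element belongs to just finitely many
maximal ideals. -/
def HasFiniteCharacter (R : Type*) [CommRing R] [IsDomain R] : Prop :=
  ∀ a : R, a ≠ 0 → InFinitelyManyMaximalIdeals a

/-- A domain `R` is Archimedean if `⋂ n, r ^ n R = 0` for each nonunit `r` of `R`. -/
def IsArchimedeanDomain (R : Type*) [CommRing R] [IsDomain R] : Prop :=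
  ∀ r : R, ¬ IsUnit r → (⨅ n : ℕ, Ideal.span {r ^ n}) = ⊥

/-- `a` belongs to a prime ideal of height one of the integral closure `R'` of the domain `R`
in its field of fractions. -/
def InHeightOnePrimeOfIntegralClosure {R : Type*} [CommRing R] [IsDomain R] (a : R) : Prop :=
  ∃ Q : Ideal (integralClosure R (FractionRing R)),
    Q.IsPrime ∧ Q.height = 1 ∧ algebraMap R (integralClosure R (FractionRing R)) a ∈ Q

/-! A stable ideal is invertible over its endomorphism ring, so powers of it can be cancelled. For
`c`, `d` integral over `R` this makes `R + Rc + Rd` a ring, giving the quadratic relation `cd ∈ R +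
Rc + Rd`. It bounds the number of maximal ideals of `R'` over one of `R`, and lets divisibility
descend from `R'` to `R` up to squaring. Invertibility of `R + Rz` makes `R'` a Prüfer domain.

If `a` lies in no height-one prime of `R'`, then at each maximal ideal `N ∋ a` the valuation ring
`R'_N` has a nonzero prime missing `a`, and its elements are divisible by all powers of `a`. There
are finitely many such `N`, so a product of witnesses works globally, and its multiple in `R`,
squared, lies in every `a^n R`. Conversely, a height-one prime `Q ∋ a` makes `R_{Q ∩ R}`
Archimedean, so `⋂ a^n R = 0`.

For finite character, infinitely many maximal ideals containing `a` would, by stability of the union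
of the `(R : ∏ M²)` over finite products, make some `(R : M²)` closed under multiplication,
impossible for stable `M`. -/

/-- A submodule `A` of a commutative algebra is stable if `1 ∈ A X` for some `X` with
`X A² ⊆ A`; for an ideal of a domain this says that it is invertible over its endomorphism
ring. -/
def Submodule.IsStable {R K : Type*} [CommRing R] [CommRing K] [Algebra R K]
    (A : Submodule R K) : Prop :=
  ∃ X : Submodule R K, 1 ≤ A * X ∧ X * (A * A) ≤ A

/-! ### Stable submodules of the fraction field -/

section Stable

variable {R K : Type*} [CommRing R] [Field K] [Algebra R K]

open IsLocalization (coeSubmodule)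

theorem Submodule.IsStable.smul {A : Submodule R K} (hA : A.IsStable) {u : K} (hu : u ≠ 0) :
    (span R {u} * A).IsStable := by
  obtain ⟨X, h1, h2⟩ := hA
  have hu1 : span R {u} * span R {u⁻¹} = 1 := by
    rw [span_mul_span, Set.singleton_mul_singleton, mul_inv_cancel₀ hu, one_eq_span]
  refine ⟨span R {u⁻¹} * X, ?_, ?_⟩
  · calc 1 ≤ (span R {u} * span R {u⁻¹}) * (A * X) := by rwa [hu1, one_mul]
      _ = _ := by ac_rfl
  · calc span R {u⁻¹} * X * (span R {u} * A * (span R {u} * A))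
        = (span R {u} * span R {u⁻¹}) * (span R {u} * (X * (A * A))) := by ac_rfl
      _ ≤ _ := by rw [hu1, one_mul]; exact mul_le_mul_right h2 _

/-- Multiplying `J^n J ≤ J^n` by powers of `X` cancels `J^n` down to `J`. -/
theorem Submodule.IsStable.mul_self_le_of_pow_succ_le {J : Submodule R K} (hJ : J.IsStable)
    {n : ℕ} (hn : J ^ (n + 1) ≤ J ^ n) : J * J ≤ J := by
  obtain ⟨X, hX1, hX2⟩ := hJ
  have hm (m : ℕ) : X ^ m * J ^ (m + 1) ≤ J := by
    induction m with
    | zero => simp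
    | succ m ih =>
      calc X ^ (m + 1) * J ^ (m + 1 + 1) = X * ((X ^ m * J ^ (m + 1)) * J) := by ring
        _ ≤ X * (J * J) := by gcongr
        _ ≤ J := hX2
  calc J * J = 1 * (J * J) := by rw [one_mul]
    _ ≤ (J * X) ^ n * (J * J) := by gcongr; exact one_le_pow₀ hX1
    _ = (X ^ n * J) * J ^ (n + 1) := by ring
    _ ≤ (X ^ n * J) * J ^ n := by gcongr
    _ = X ^ n * J ^ (n + 1) := by ring
    _ ≤ J := hm n

/-- The powers of the span increase to `R[s]`, a finite module, so one of them contains its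
generators. -/
theorem Submodule.exists_pow_succ_le_of_isIntegral {s : Set K} (hs : s.Finite)
    (hint : ∀ x ∈ s, IsIntegral R x) (h1 : 1 ≤ span R s) :
    ∃ n : ℕ, span R s ^ (n + 1) ≤ span R s ^ n := by
  have hmono : Monotone fun n : ℕ => span R s ^ n := pow_right_monotone h1
  have hle (n : ℕ) : span R s ^ n ≤ (Algebra.adjoin R s).toSubmodule := by
    induction n with
    | zero => rw [pow_zero, one_le]; exact one_mem (Algebra.adjoin R s)
    | succ n ih =>
      rw [pow_succ, mul_le]
      exact fun x hx y hy => mul_mem (S := Subalgebra R K) (ih hx)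
        (Algebra.span_le_adjoin R s hy)
  have hex : ∀ x ∈ Algebra.adjoin R s, ∃ n : ℕ, x ∈ span R s ^ n := by
    intro x hx
    induction hx using Algebra.adjoin_induction with
    | mem x hx => exact ⟨1, by simpa using subset_span hx⟩
    | algebraMap r => exact ⟨0, by simp⟩
    | add x y _ _ hx hy =>
      obtain ⟨m, hm⟩ := hx
      obtain ⟨n, hn⟩ := hy
      exact ⟨max m n, add_mem (hmono (le_max_left m n) hm) (hmono (le_max_right m n) hn)⟩
    | mul x y _ _ hx hy =>
      obtain ⟨m, hm⟩ := hx
      obtain ⟨n, hn⟩ := hy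
      exact ⟨m + n, by rw [pow_add]; exact mul_mem_mul hm hn⟩
  obtain ⟨t, ht⟩ := fg_adjoin_of_finite hs hint
  have htn : ∃ n : ℕ, ∀ x ∈ t, x ∈ span R s ^ n := by
    have h : ∀ x ∈ t, ∃ n : ℕ, x ∈ span R s ^ n := fun x hx => 
      hex x (by rw [← Subalgebra.mem_toSubmodule, ← ht]; exact subset_span hx)
    choose! f hf using h
    exact ⟨t.sup f, fun x hx => hmono (Finset.le_sup hx) (hf x hx)⟩
  obtain ⟨n, hn⟩ := htn
  exact ⟨n, (hle (n + 1)).trans (ht ▸ span_le.2 hn)⟩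

variable [IsFractionRing R K]

/-- A dual basis over `End I` gives the inverse: endomorphisms of `I` are multiplications by
elements of `K`, and so are the coordinate maps `I → End I`. -/
theorem IsStableIdeal.isStable_coeSubmodule {I : Ideal R} (hI : IsStableIdeal I) (h0 : I ≠ ⊥) :
    (coeSubmodule K I).IsStable := by
  obtain ⟨x, hxI, hx0⟩ := Submodule.exists_mem_ne_zero_of_ne_bot h0
  obtain ⟨s, hs⟩ := Module.projective_def.1 hI
  have hxK : algebraMap R K x ≠ 0 := by simpa using hx0
  have hsmul (r : R) (z : I) (y : I) : s (r • z) y = r • s z y := by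
    have h := s.map_smul (r • (1 : Module.End R I)) z
    have h1 : (r • (1 : Module.End R I)) • z = r • z := by simp
    rw [h1] at h
    rw [h, Finsupp.smul_apply, smul_eq_mul, smul_mul_assoc, one_mul]
  have hlin (e : Module.End R I) (y z : I) : (z : R) * (e y : R) = (y : R) * (e z : R) := by
    have h1 : (z : R) • y = (y : R) • z := Subtype.ext (by simp [mul_comm])
    have h2 := congrArg (fun w => ((e w : I) : R)) h1
    simpa using h2
  have key (y z w : I) : (z : R) * ((s ⟨x, hxI⟩ y) w : R) = x * ((s z y) w : R) := by
    have h1 : (z : R) • (⟨x, hxI⟩ : I) = x • z := Subtype.ext (by simp [mul_comm])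
    have h2 := congrArg (fun v => ((s v y w : I) : R)) h1
    simp only [hsmul] at h2
    simpa using h2
  -- The `y`-th coordinate map is multiplication by `q y`: it sends `x` to an endomorphism with
  -- ratio `s x y x / x`, and one more division by `x` gives the multiplier.
  let q (y : I) : K := algebraMap R K (s ⟨x, hxI⟩ y ⟨x, hxI⟩ : I) / algebraMap R K x ^ 2
  refine ⟨Submodule.span R (Set.range q), ?_, ?_⟩
  · rw [Submodule.one_le]
    have h1 : (1 : K) = ∑ y ∈ (s ⟨x, hxI⟩).support, algebraMap R K y * q y := by
      have h2 := congrArg (fun v : I => algebraMap R K (v : R)) (hs ⟨x, hxI⟩)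
      simp only [Finsupp.linearCombination_apply, Finsupp.sum, id, Module.End.smul_def,
        AddSubmonoidClass.coe_finsetSum, map_sum] at h2
      have h3 : ∀ y : I, algebraMap R K y * q y =
          algebraMap R K (s ⟨x, hxI⟩ y y : I) / algebraMap R K x := by
        intro y
        have := congrArg (algebraMap R K) (hlin (s ⟨x, hxI⟩ y) ⟨x, hxI⟩ y)
        simp only [map_mul] at this
        simp only [q]
        field_simp
        exact this
      rw [Finset.sum_congr rfl fun y _ => h3 y, ← Finset.sum_div, h2, div_self hxK]
    rw [h1]
    exact Submodule.sum_mem _ fun y _ =>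
      Submodule.mul_mem_mul (Submodule.mem_map_of_mem y.2) (Submodule.subset_span ⟨y, rfl⟩)
  · rw [Submodule.mul_le]
    intro m hm n hn
    induction hm using Submodule.span_induction with
    | zero => simp
    | add a b _ _ ha hb => rw [add_mul]; exact add_mem ha hb
    | smul r a _ ha => rw [smul_mul_assoc]; exact Submodule.smul_mem _ _ ha
    | mem a ha =>
      obtain ⟨y, rfl⟩ := ha
      induction hn using Submodule.mul_induction_on' with
      | add a _ b _ ha hb => rw [mul_add]; exact add_mem ha hb
      | mem_mul_mem a ha b hb =>
        obtain ⟨z, hz, rfl⟩ := ha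
        obtain ⟨w, hw, rfl⟩ := hb
        refine ⟨s ⟨z, hz⟩ y ⟨w, hw⟩, (s ⟨z, hz⟩ y ⟨w, hw⟩).2, ?_⟩
        have h1 := congrArg (algebraMap R K) (key y ⟨z, hz⟩ ⟨w, hw⟩)
        have h2 := congrArg (algebraMap R K) (hlin (s ⟨x, hxI⟩ y) ⟨x, hxI⟩ ⟨w, hw⟩)
        simp only [map_mul] at h1 h2
        simp only [q, Algebra.linearMap_apply]
        rw [eq_comm, div_mul_eq_mul_div, div_eq_iff (by positivity)]
        linear_combination (algebraMap R K x) * h1 + (algebraMap R K z) * h2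

/-- A fractional ideal is stable if the corresponding integral ideal is. -/
theorem Submodule.isStable_of_isStableIdeal_comap {A : Submodule R K} (hA : A ≠ ⊥) {d : R}
    (hd : d ≠ 0) (hdA : ∀ b ∈ A, IsLocalization.IsInteger R (d • b))
    (h : ∀ I : Ideal R, I ≠ ⊥ → (coeSubmodule K I = span R {algebraMap R K d} * A) →
      IsStableIdeal I) : A.IsStable := by
  have hdK : algebraMap R K d ≠ 0 := by simpa using hd
  have hA' : coeSubmodule K ((span R {algebraMap R K d} * A).comap (Algebra.linearMap R K)) =
      span R {algebraMap R K d} * A := by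
    apply Submodule.map_comap_eq_of_le
    intro z hz
    obtain ⟨b, hb, rfl⟩ := mem_span_singleton_mul.1 hz
    obtain ⟨r, hr⟩ := hdA b hb
    exact ⟨r, by rw [Algebra.linearMap_apply, hr, Algebra.smul_def]⟩
  have hback : span R {(algebraMap R K d)⁻¹} * (span R {algebraMap R K d} * A) = A := by
    rw [← mul_assoc, span_mul_span, Set.singleton_mul_singleton, inv_mul_cancel₀ hdK,
      ← one_eq_span, one_mul]
  have h0 : (span R {algebraMap R K d} * A).comap (Algebra.linearMap R K) ≠ (⊥ : Ideal R) := by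
    intro h0
    rw [h0, IsLocalization.coeSubmodule_bot] at hA'
    rw [← hA', mul_bot] at hback
    exact hA hback.symm
  have := ((h _ h0 hA').isStable_coeSubmodule (K := K) h0).smul (inv_ne_zero hdK)
  rwa [hA', hback] at this

/-! ### Integral elements over a finitely stable domain -/

variable [IsDomain R]

theorem IsFinitelyStableDomain.isStable (hR : IsFinitelyStableDomain R) {A : Submodule R K}
    (hA : A ≠ ⊥) (hfg : A.FG) : A.IsStable := by
  obtain ⟨d, hd, hdA⟩ := FractionalIdeal.isFractional_of_fg (S := nonZeroDivisors R) hfg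
  refine Submodule.isStable_of_isStableIdeal_comap hA (nonZeroDivisors.ne_zero hd) hdA
    fun I h0 hI => hR I ?_ h0
  refine (IsLocalization.coeSubmodule_fg K (IsFractionRing.injective R K) I).1 ?_
  rw [hI]
  exact (Submodule.fg_span_singleton _).mul hfg

theorem IsStableDomain.isStable (hR : IsStableDomain R) {A : Submodule R K} (hA : A ≠ ⊥) {d : R}
    (hd : d ≠ 0) (hdA : ∀ b ∈ A, IsLocalization.IsInteger R (d • b)) : A.IsStable :=
  Submodule.isStable_of_isStableIdeal_comap hA hd hdA fun I h0 _ => hR I h0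

theorem IsFinitelyStableDomain.mul_mem_of_isIntegral (hR : IsFinitelyStableDomain R) {c d : K}
    (hc : IsIntegral R c) (hd : IsIntegral R d) :
    ∃ r s t : R, c * d = algebraMap R K r + algebraMap R K s * c + algebraMap R K t * d := by
  let J : Submodule R K := Submodule.span R {1, c, d}
  have h1 : 1 ≤ J := Submodule.one_le.2 (Submodule.subset_span (by simp))
  have hfin : ({1, c, d} : Set K).Finite := by simp
  obtain ⟨n, hn⟩ := Submodule.exists_pow_succ_le_of_isIntegral (R := R) (s := {1, c, d}) hfin
    (by simp [hc, hd, isIntegral_one]) h1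
  have h0 : J ≠ ⊥ := by
    rintro h
    rw [h, Submodule.one_le] at h1
    exact one_ne_zero ((Submodule.mem_bot R).1 h1)
  have hJ := (hR.isStable h0 (Submodule.fg_span hfin)).mul_self_le_of_pow_succ_le hn
  have hcd : c * d ∈ J := hJ (Submodule.mul_mem_mul (Submodule.subset_span (by simp))
    (Submodule.subset_span (by simp)))
  obtain ⟨r, s, t, h⟩ := Submodule.mem_span_triple.1 hcd
  exact ⟨r, s, t, by simpa [Algebra.smul_def] using h.symm⟩

/-- The integral closure of a finitely stable domain is a Prüfer domain: it has enough
denominators for the localizations at its primes to be valuation rings. -/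
theorem IsFinitelyStableDomain.exists_add_eq_one (hR : IsFinitelyStableDomain R) (z : K) :
    ∃ q r : K, IsIntegral R q ∧ IsIntegral R (q * z) ∧ IsIntegral R r ∧ IsIntegral R (r * z) ∧
      q + r * z = 1 := by
  let J : Submodule R K := Submodule.span R {1, z}
  have hJ1 : (1 : K) ∈ J := Submodule.subset_span (by simp)
  have hJz : z ∈ J := Submodule.subset_span (by simp)
  have h0 : J ≠ ⊥ := fun h => one_ne_zero ((Submodule.mem_bot R).1 (h ▸ hJ1))
  have hfg : J.FG := Submodule.fg_span (by simp)
  obtain ⟨X, hX1, hX2⟩ := hR.isStable h0 hfg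
  -- `X J` maps the finitely generated module `J` into itself, hence is integral.
  have hint {e x : K} (he : e ∈ X) (hx : x ∈ J) : IsIntegral R (e * x) := by
    refine isIntegral_of_smul_mem_submodule J h0 hfg _ fun y hy => ?_
    rw [smul_eq_mul, mul_assoc]
    exact hX2 (Submodule.mul_mem_mul he (Submodule.mul_mem_mul hx hy))
  have hsup : J * X = X ⊔ Submodule.span R {z} * X := by
    simp only [J]
    rw [Submodule.span_insert, ← Submodule.one_eq_span, Submodule.sup_mul, one_mul]
  rw [hsup, Submodule.one_le, Submodule.mem_sup] at hX1
  obtain ⟨q, hq, w, hw, hqw⟩ := hX1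
  obtain ⟨r, hr, rfl⟩ := Submodule.mem_span_singleton_mul.1 hw
  exact ⟨q, r, by simpa using hint hq hJ1, hint hq hJz, by simpa using hint hr hJ1, hint hr hJz,
    by rw [mul_comm r, hqw]⟩

end Stable

/-! ### Finite character of stable domains -/

open IsLocalization (coeSubmodule) in
/-- The square of a proper nonzero stable ideal `M` has a conductor `(R : M²)` that is not closed
under multiplication. -/
theorem not_mul_self_le_of_isStable {R K : Type*} [CommRing R] [Field K] [Algebra R K]
    [IsFractionRing R K] {M : Ideal R} (hM : (coeSubmodule K M).IsStable) (htop : M ≠ ⊤)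
    {F : Submodule R K} (hF : F = 1 / coeSubmodule K (M ^ 2)) : ¬ F * F ≤ F := by
  intro h
  obtain ⟨Y, h1, h2⟩ := hM
  have hM1 : coeSubmodule K M ≤ 1 := by
    rw [← IsLocalization.coeSubmodule_top]; exact IsLocalization.coeSubmodule_mono K le_top
  have hYF : Y ≤ F := by
    rw [hF, Submodule.le_div_iff_mul_le, pow_two, IsLocalization.coeSubmodule_mul]
    exact h2.trans hM1
  have hFM : F * (coeSubmodule K M * coeSubmodule K M) ≤ 1 := by
    rw [← IsLocalization.coeSubmodule_mul, ← pow_two, ← Submodule.le_div_iff_mul_le, hF]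
  -- Inserting `1 ≤ M Y` twice gives `Y ≤ Y³ M²`, and `Y³ ≤ F`.
  have hY1 : Y ≤ 1 := by
    calc Y = Y * (1 * 1) := by simp
      _ ≤ Y * ((coeSubmodule K M * Y) * (coeSubmodule K M * Y)) := by gcongr
      _ = (Y * Y * Y) * (coeSubmodule K M * coeSubmodule K M) := by ring
      _ ≤ (F * F * F) * (coeSubmodule K M * coeSubmodule K M) := by gcongr
      _ ≤ (F * F) * (coeSubmodule K M * coeSubmodule K M) := by gcongr
      _ ≤ F * (coeSubmodule K M * coeSubmodule K M) := by gcongr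
      _ ≤ 1 := hFM
  have h3 : 1 ≤ coeSubmodule K M := by
    calc 1 ≤ coeSubmodule K M * Y := h1
      _ ≤ coeSubmodule K M * 1 := by gcongr
      _ = _ := mul_one _
  rw [← IsLocalization.coeSubmodule_top, IsFractionRing.coeSubmodule_le_coeSubmodule] at h3
  exact htop (top_le_iff.1 h3)

open IsLocalization (coeSubmodule) in
/-- A stable domain has finite character. -/
theorem IsStableDomain.hasFiniteCharacter {R : Type*} [CommRing R] [IsDomain R]
    (hR : IsStableDomain R) : HasFiniteCharacter R := by
  classical
  intro a ha
  by_contra hinf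
  let K := FractionRing R
  let S : Set (Ideal R) := {M : Ideal R | M.IsMaximal ∧ a ∈ M}
  have : Infinite S := Set.infinite_coe_iff.2 hinf
  have hcop (M N : S) (h : M ≠ N) : IsCoprime (M.1 ^ 2) (N.1 ^ 2) := by
    have := M.2.1
    have := N.2.1
    exact (Ideal.isCoprime_of_isMaximal fun h' => h (Subtype.ext h')).pow
  let P (s : Finset S) : Ideal R := ∏ M ∈ s, M.1 ^ 2
  have haP (s : Finset S) : a ^ 2 ∈ P s := by
    rw [show P s = ⨅ M ∈ s, M.1 ^ 2 from
      Ideal.prod_eq_iInf_of_pairwise_isCoprime fun M _ N _ h => hcop M N h]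
    simp only [Submodule.mem_iInf]
    exact fun M _ => Ideal.pow_mem_pow M.2.2 2
  -- All `B s` have the common denominator `a²`, so their directed union is still fractional.
  let B (s : Finset S) : Submodule R K := 1 / coeSubmodule K (P s)
  have hBP (s : Finset S) : B s * coeSubmodule K (P s) ≤ 1 :=
    Submodule.le_div_iff_mul_le.1 le_rfl
  have hBmono : Monotone B := by
    intro s t hst
    have hP : P t ≤ P s := Ideal.le_of_dvd (Finset.prod_dvd_prod_of_subset _ _ _ hst)
    rw [Submodule.le_div_iff_mul_le]
    exact (mul_le_mul_right (IsLocalization.coeSubmodule_mono K hP) _).trans (hBP s)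
  have hmem (x : K) : x ∈ ⨆ s, B s ↔ ∃ s, x ∈ B s :=
    Submodule.mem_iSup_of_directed _ hBmono.directed_le
  have h1B : (1 : K) ∈ B ∅ := by
    simp only [B, P, Finset.prod_empty, Ideal.one_eq_top, IsLocalization.coeSubmodule_top]
    rw [Submodule.mem_div_iff_forall_mul_mem]
    simp
  have hstab : (⨆ s, B s).IsStable := by
    refine hR.isStable (fun h => ?_) (pow_ne_zero 2 ha) fun x hx => ?_
    · have := (hmem 1).2 ⟨_, h1B⟩
      rw [h] at this
      exact one_ne_zero ((Submodule.mem_bot R).1 this)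
    · obtain ⟨s, hs⟩ := (hmem x).1 hx
      obtain ⟨r, hr⟩ := Submodule.mem_one.1
        (hBP s (Submodule.mul_mem_mul hs (Submodule.mem_map_of_mem (haP s))))
      exact ⟨r, by rw [hr, Algebra.smul_def, mul_comm, Algebra.linearMap_apply]⟩
  obtain ⟨X, hX1, hX2⟩ := hstab
  have hX1' : ∃ s, 1 ≤ B s * X := by
    rw [Submodule.iSup_mul, Submodule.one_le, Submodule.mem_iSup_of_directed] at hX1
    · simpa only [Submodule.one_le] using hX1
    · exact Monotone.directed_le fun s t h => mul_le_mul_left (hBmono h) _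
  obtain ⟨s, hs⟩ := hX1'
  obtain ⟨M, hM⟩ := Infinite.exists_notMem_finset s
  let F : Submodule R K := 1 / coeSubmodule K (M.1 ^ 2)
  have hFk : F * coeSubmodule K (M.1 ^ 2) ≤ 1 := Submodule.le_div_iff_mul_le.1 le_rfl
  have hFB : F ≤ ⨆ s, B s := by
    refine le_trans (le_of_eq ?_) (le_iSup B {M})
    simp [F, B, P]
  have hFFB : F * F * coeSubmodule K (P s) ≤ ⨆ s, B s := by
    calc F * F * coeSubmodule K (P s)
        ≤ F * F * coeSubmodule K (P s) * (B s * X) := le_mul_of_one_le_right' hs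
      _ = (B s * coeSubmodule K (P s)) * (X * (F * F)) := by ring
      _ ≤ 1 * (X * ((⨆ s, B s) * (⨆ s, B s))) := by gcongr; exact hBP s
      _ ≤ _ := by rw [one_mul]; exact hX2
  -- Such a `w` lies in some `B t`, and `w M⁴ ≤ R`. Splitting `1` between `M²` and the other factors
  -- of `P t` improves this to `w M² ≤ R`.
  have hFFF : F * F * coeSubmodule K (P s) ≤ F := by
    intro w hw
    have hwkk : ∀ x ∈ M.1 ^ 2, ∀ y ∈ M.1 ^ 2, w * (algebraMap R K x * algebraMap R K y) ∈
        (1 : Submodule R K) := by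
      intro x hx y hy
      have : F * F * coeSubmodule K (P s) *
          (coeSubmodule K (M.1 ^ 2) * coeSubmodule K (M.1 ^ 2)) ≤ 1 := by
        calc _ = (F * coeSubmodule K (M.1 ^ 2)) * (F * coeSubmodule K (M.1 ^ 2)) *
              coeSubmodule K (P s) := by ring
          _ ≤ 1 * 1 * 1 := by
            gcongr
            rw [← IsLocalization.coeSubmodule_top]
            exact IsLocalization.coeSubmodule_mono K le_top
          _ = 1 := by simp
      exact this (Submodule.mul_mem_mul hw (Submodule.mul_mem_mul
        (Submodule.mem_map_of_mem hx) (Submodule.mem_map_of_mem hy)))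
    obtain ⟨t, ht⟩ := (hmem w).1 (hFFB hw)
    have ht' : w ∈ B (insert M (t.erase M)) := hBmono (Finset.insert_erase_subset M t) ht
    have hc : IsCoprime (M.1 ^ 2) (P (t.erase M)) :=
      IsCoprime.prod_right fun N hN => hcop M N (Finset.ne_of_mem_erase hN).symm
    obtain ⟨i, hi, j, hj, hij⟩ := hc.exists
    rw [Submodule.mem_div_iff_forall_mul_mem]
    rintro _ ⟨x, hx, rfl⟩
    have hxj : x * j ∈ P (insert M (t.erase M)) := by
      simp only [P]
      rw [Finset.prod_insert (Finset.notMem_erase M t)]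
      exact Ideal.mul_mem_mul hx hj
    have h2 := hBP _ (Submodule.mul_mem_mul ht' (Submodule.mem_map_of_mem hxj))
    have h3 := add_mem (hwkk x hx i hi) h2
    convert h3 using 1
    rw [Algebra.linearMap_apply, Algebra.linearMap_apply, map_mul, ← mul_add, ← mul_add,
      ← map_add, hij, map_one, mul_one]
  have hcs : IsCoprime (M.1 ^ 2) (P s) :=
    IsCoprime.prod_right fun N hN => hcop M N fun h => hM (h ▸ hN)
  refine not_mul_self_le_of_isStable (K := K) (M := M.1) ?_ M.2.1.ne_top rfl (?_ : F * F ≤ F)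
  · have h0 : M.1 ≠ ⊥ := fun h => ha (by simpa [h] using M.2.2)
    exact (hR _ h0).isStable_coeSubmodule h0
  · calc F * F = F * F * (coeSubmodule K (M.1 ^ 2) ⊔ coeSubmodule K (P s)) := by
          rw [← IsLocalization.coeSubmodule_sup, hcs.sup_eq, IsLocalization.coeSubmodule_top,
            mul_one]
      _ = F * (F * coeSubmodule K (M.1 ^ 2)) ⊔ F * F * coeSubmodule K (P s) := by
          rw [Submodule.mul_sup, mul_assoc]
      _ ≤ F := sup_le (by simpa using mul_le_mul_right hFk F) hFFF

/-! ### Height-one primes and divisibility by all powers -/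

section Prime

variable {D : Type*} [CommRing D] [IsDomain D]

theorem Ideal.eq_of_le_of_height_eq_one {p Q : Ideal D} [p.IsPrime] [Q.IsPrime]
    (hQ : Q.height = 1) (hp : p ≠ ⊥) (hpQ : p ≤ Q) : p = Q := by
  by_contra hne
  have h := Ideal.height_le_iff (p := Q) (n := 1) |>.1 (by simp [hQ]) p inferInstance
    (lt_of_le_of_ne hpQ hne)
  rw [Nat.cast_one, Order.lt_one_iff, Ideal.height_eq_zero_iff_eq_bot] at h
  exact hp h

theorem Ideal.height_eq_one_of_forall_le {Q : Ideal D} [Q.IsPrime] (hQ : Q ≠ ⊥)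
    (h : ∀ p : Ideal D, p.IsPrime → p ≠ ⊥ → p ≤ Q → p = Q) : Q.height = 1 := by
  apply le_antisymm
  · refine Ideal.height_le_iff (p := Q) (n := 1) |>.2 fun p hp hpQ => ?_
    have hp0 : p = ⊥ := by
      by_contra hne
      exact hpQ.ne (h p hp hne hpQ.le)
    simp [hp0]
  · rw [Order.one_le_iff_ne_zero, Ne, Ideal.height_eq_zero_iff_eq_bot]
    exact hQ

/-- Localized at a height-one prime `Q`, a nonzero element is not divisible by all powers of an
element of `Q`. -/
theorem Ideal.eq_zero_of_forall_pow_dvd_of_height_eq_one {Q : Ideal D} [Q.IsPrime]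
    (hQ : Q.height = 1) {r b : D} (hr : r ∈ Q) (h : ∀ n : ℕ, ∃ s ∉ Q, r ^ n ∣ s * b) : b = 0 := by
  by_contra hb
  -- A prime inside `Q` containing `b ≠ 0` is `Q`, which contains `r`. So `b` divides some `s * r ^
  -- k` with `s ∉ Q`.
  have hdisj : ¬ Disjoint (Ideal.span {b} : Set D)
      (Q.primeCompl ⊔ Submonoid.powers r : Submonoid D) := by
    intro hdisj
    obtain ⟨p, hp, hbp, hpS⟩ := Ideal.exists_le_prime_disjoint _ _ hdisj
    have hb' : b ∈ p := hbp (Ideal.mem_span_singleton_self b)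
    have hpQ : p ≤ Q := fun x hx => by
      by_contra hxQ
      exact Set.disjoint_left.1 hpS hx (Submonoid.mem_sup_left (show x ∈ Q.primeCompl from hxQ))
    have := Ideal.eq_of_le_of_height_eq_one hQ (fun h0 => hb (by simpa [h0] using hb')) hpQ
    exact Set.disjoint_left.1 hpS (this ▸ hr)
      (Submonoid.mem_sup_right (Submonoid.mem_powers r))
  obtain ⟨x, hxb, hx⟩ := Set.not_disjoint_iff.1 hdisj
  obtain ⟨s, hs, _, ⟨k, rfl⟩, rfl⟩ := Submonoid.mem_sup.1 hx
  obtain ⟨d, hd⟩ := Ideal.mem_span_singleton.1 hxb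
  -- One power more than `k` leaves a factor `r` after cancelling, forcing `s * t ∈ Q`.
  obtain ⟨t, ht, c, hc⟩ := h (k + 1)
  have hs' : s ∉ Q := hs
  by_cases hr0 : r = 0
  · rw [hr0, zero_pow k.succ_ne_zero, zero_mul, mul_eq_zero] at hc
    exact ht ((hc.resolve_right hb) ▸ Q.zero_mem)
  · have : s * t = r * (c * d) := by
      apply mul_right_cancel₀ (pow_ne_zero k hr0)
      linear_combination t * hd + d * hc
    exact (Ideal.IsPrime.mem_or_mem ‹_› (this ▸ Q.mul_mem_right _ hr)).elim hs' ht

/-- If the localization of `D` at the prime `N` is a valuation ring and `a ∈ N` lies in no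
height-one prime, then some nonzero element is divisible in the localization by all powers
of `a`. -/
theorem Ideal.exists_ne_zero_forall_pow_dvd {N : Ideal D} [N.IsPrime]
    (hN : ∀ x y : D, ∃ s ∉ N, y ∣ s * x ∨ x ∣ s * y) {a : D} (ha0 : a ≠ 0) (ha : a ∈ N)
    (h : ∀ Q : Ideal D, Q.IsPrime → Q.height = 1 → a ∉ Q) :
    ∃ b ≠ 0, ∀ n : ℕ, ∃ s ∉ N, a ^ n ∣ s * b := by
  obtain ⟨Q, hQ, hQN⟩ := Ideal.exists_minimalPrimes_le
    (I := Ideal.span {a}) (J := N) ((Ideal.span_singleton_le_iff_mem N).2 ha)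
  have hQp : Q.IsPrime := hQ.1.1
  have haQ : a ∈ Q := hQ.1.2 (Ideal.mem_span_singleton_self a)
  have hex : ∃ p : Ideal D, p.IsPrime ∧ p ≠ ⊥ ∧ p ≤ Q ∧ p ≠ Q := by
    by_contra! hcon
    exact h Q hQp (Ideal.height_eq_one_of_forall_le (fun h0 => ha0 (by simpa [h0] using haQ))
      hcon) haQ
  obtain ⟨p, hp, hp0, hpQ, hpne⟩ := hex
  have hap : a ∉ p := fun hap =>
    hpne (le_antisymm hpQ (hQ.2 ⟨hp, (Ideal.span_singleton_le_iff_mem p).2 hap⟩ hpQ))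
  obtain ⟨b, hb, hb0⟩ := Submodule.exists_mem_ne_zero_of_ne_bot hp0
  refine ⟨b, hb0, fun n => ?_⟩
  obtain ⟨s, hs, hsb | ⟨d, hd⟩⟩ := hN b (a ^ n)
  · exact ⟨s, hs, hsb⟩
  · exfalso
    rcases hp.mem_or_mem (hd ▸ p.mul_mem_right d hb : s * a ^ n ∈ p) with hsp | hap'
    · exact hs (hQN (hpQ hsp))
    · exact hap (hp.mem_of_pow_mem n hap')

/-- Globalization of `Ideal.exists_ne_zero_forall_pow_dvd`. -/
theorem exists_ne_zero_forall_pow_dvd_of_finite {a : D}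
    (hfin : {N : Ideal D | N.IsMaximal ∧ a ∈ N}.Finite)
    (h : ∀ N : Ideal D, N.IsMaximal → a ∈ N → ∃ b ≠ 0, ∀ n : ℕ, ∃ s ∉ N, a ^ n ∣ s * b) :
    ∃ b ≠ 0, ∀ n : ℕ, a ^ n ∣ b := by
  choose! f hf0 hf using h
  refine ⟨∏ N ∈ hfin.toFinset, f N, Finset.prod_ne_zero_iff.2 fun N hN => ?_, fun n => ?_⟩
  · rw [Set.Finite.mem_toFinset] at hN
    exact hf0 N hN.1 hN.2
  · set b := ∏ N ∈ hfin.toFinset, f N with hb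
    by_contra hnd
    -- The multipliers `s` with `a ^ n ∣ s * b`; no maximal ideal contains all of them.
    let I : Ideal D := Submodule.comap (LinearMap.mulRight D b) (Ideal.span {a ^ n})
    have hI (s : D) : s ∈ I ↔ a ^ n ∣ s * b := Ideal.mem_span_singleton
    obtain ⟨N, hN, hIN⟩ := Ideal.exists_le_maximal I fun htop => hnd (by
      have := (hI 1).1 (by rw [htop]; trivial)
      rwa [one_mul] at this)
    by_cases haN : a ∈ N
    · obtain ⟨s, hs, hsb⟩ := hf N hN haN n
      have hmem : N ∈ hfin.toFinset := hfin.mem_toFinset.2 ⟨hN, haN⟩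
      exact hs (hIN ((hI s).2 (hsb.trans (mul_dvd_mul_left s (Finset.dvd_prod_of_mem f hmem)))))
    · exact haN (hN.isPrime.mem_of_pow_mem n (hIN ((hI _).2 (dvd_mul_right _ _))))

end Prime

/-! ### The integral closure of a finitely stable domain -/

section IntegralClosure

theorem Ideal.exists_mem_sub_one_mem {D : Type*} [CommRing D] {I J I' J' : Ideal D}
    (h1 : IsCoprime I I') (h2 : IsCoprime I J') (h3 : IsCoprime J I') (h4 : IsCoprime J J') :
    ∃ c : D, c ∈ I ∧ c ∈ J ∧ c - 1 ∈ I' ∧ c - 1 ∈ J' := by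
  have key {I : Ideal D} (h : IsCoprime I I') (h' : IsCoprime I J') :
      ∃ x ∈ I, x - 1 ∈ I' ∧ x - 1 ∈ J' := by
    obtain ⟨i, hi, k, hk, hik⟩ := h.exists
    obtain ⟨j, hj, l, hl, hjl⟩ := h'.exists
    have e : i + k * j - 1 = -(k * l) := by linear_combination hik + k * hjl
    exact ⟨i + k * j, add_mem hi (I.mul_mem_left k hj),
      e ▸ neg_mem (I'.mul_mem_right l hk), e ▸ neg_mem (J'.mul_mem_left k hl)⟩
  obtain ⟨x, hx, hx1, hx2⟩ := key h1 h2
  obtain ⟨y, hy, hy1, hy2⟩ := key h3 h4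
  have e : x * y - 1 = x * (y - 1) + (x - 1) := by ring
  exact ⟨x * y, I.mul_mem_right y hx, J.mul_mem_left x hy,
    e ▸ add_mem (I'.mul_mem_left x hy1) hx1, e ▸ add_mem (J'.mul_mem_left x hy2) hx2⟩

variable {R K : Type*} [CommRing R] [IsDomain R] [Field K] [Algebra R K] [IsFractionRing R K]

theorem IsFinitelyStableDomain.exists_notMem_dvd (hR : IsFinitelyStableDomain R)
    {N : Ideal (integralClosure R K)} [N.IsPrime] (x y : integralClosure R K) :
    ∃ s ∉ N, y ∣ s * x ∨ x ∣ s * y := by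
  by_cases hx : x = 0
  · exact ⟨1, N.one_notMem, Or.inl (by simp [hx])⟩
  have hxK : (x : K) ≠ 0 := by simpa using hx
  obtain ⟨q, r, hq, hqz, hr, hrz, h⟩ := hR.exists_add_eq_one ((y : K) / x)
  have h1 : (⟨q, hq⟩ : integralClosure R K) + ⟨_, hrz⟩ = 1 := Subtype.ext h
  by_cases hqN : (⟨q, hq⟩ : integralClosure R K) ∈ N
  · refine ⟨⟨_, hrz⟩, fun hN => N.one_notMem (h1 ▸ N.add_mem hqN hN), Or.inl ⟨⟨r, hr⟩, ?_⟩⟩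
    apply Subtype.ext
    simp only [MulMemClass.coe_mul]
    field_simp
  · refine ⟨⟨q, hq⟩, hqN, Or.inr ⟨⟨_, hqz⟩, ?_⟩⟩
    apply Subtype.ext
    simp only [MulMemClass.coe_mul]
    field_simp

/-- Four maximal ideals over `M` already contradict the quadratic relation. Take `c` with residues
1, 1, 0, 0 and `d` with residues 1, 0, 1, 0 at `N 0`, …, `N 3`. Reading `c d = r + s c + t d` at `N
3`, `N 2`, `N 1` puts `r`, `t`, `s` in `M`, so at `N 0` it says `1 = 0`. -/
theorem IsFinitelyStableDomain.finite_isMaximal_comap_eq (hR : IsFinitelyStableDomain R)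
    (M : Ideal R) : {N : Ideal (integralClosure R K) | N.IsMaximal ∧
      N.comap (algebraMap R (integralClosure R K)) = M}.Finite := by
  by_contra hinf
  have : Infinite {N : Ideal (integralClosure R K) | N.IsMaximal ∧
      N.comap (algebraMap R (integralClosure R K)) = M} := Set.infinite_coe_iff.2 hinf
  let N := Infinite.natEmbedding {N : Ideal (integralClosure R K) | N.IsMaximal ∧
      N.comap (algebraMap R (integralClosure R K)) = M}
  have hcop (i j : ℕ) (h : i ≠ j) : IsCoprime (N i).1 (N j).1 := by
    have := (N i).2.1
    have := (N j).2.1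
    exact Ideal.isCoprime_of_isMaximal fun h' => h (N.injective (Subtype.ext h'))
  have hcop4 (i j k l : ℕ) (h1 : i ≠ k) (h2 : i ≠ l) (h3 : j ≠ k) (h4 : j ≠ l) :
      ∃ c : integralClosure R K, c ∈ (N i).1 ∧ c ∈ (N j).1 ∧ c - 1 ∈ (N k).1 ∧
        c - 1 ∈ (N l).1 :=
    Ideal.exists_mem_sub_one_mem (hcop i k h1) (hcop i l h2) (hcop j k h3) (hcop j l h4)
  obtain ⟨c, hc2, hc3, hc0, hc1⟩ := hcop4 2 3 0 1 (by simp) (by simp) (by simp) (by simp)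
  obtain ⟨d, hd1, hd3, hd0, hd2⟩ := hcop4 1 3 0 2 (by simp) (by simp) (by simp) (by simp)
  obtain ⟨r, s, t, h⟩ := hR.mul_mem_of_isIntegral c.2 d.2
  let φ := algebraMap R (integralClosure R K)
  have h' : c * d = φ r + φ s * c + φ t * d := Subtype.ext h
  have hM (x : R) (i j : ℕ) (hx : φ x ∈ (N i).1) : φ x ∈ (N j).1 := by
    have hx' : x ∈ (N i).1.comap φ := hx
    rw [(N i).2.2, ← (N j).2.2] at hx'
    exact hx'
  have hr : φ r ∈ (N 3).1 := by
    have : φ r = c * (d - φ s) - φ t * d := by linear_combination -h'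
    rw [this]
    exact sub_mem (Ideal.mul_mem_right _ _ hc3) (Ideal.mul_mem_left _ _ hd3)
  have ht : φ t ∈ (N 2).1 := by
    have : φ t = c * (d - φ s) - φ r - φ t * (d - 1) := by linear_combination -h'
    rw [this]
    exact sub_mem (sub_mem (Ideal.mul_mem_right _ _ hc2) (hM r 3 2 hr))
      (Ideal.mul_mem_left _ _ hd2)
  have hs : φ s ∈ (N 1).1 := by
    have : φ s = d * (c - φ t) - φ r - φ s * (c - 1) := by linear_combination -h'
    rw [this]
    exact sub_mem (sub_mem (Ideal.mul_mem_right _ _ hd1) (hM r 3 1 hr))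
      (Ideal.mul_mem_left _ _ hc1)
  have h1 : (1 : integralClosure R K) ∈ (N 0).1 := by
    have : (1 : integralClosure R K) =
        φ r + φ s * c + φ t * d - (c - 1) * d - (d - 1) := by linear_combination h'
    rw [this]
    exact sub_mem (sub_mem (add_mem (add_mem (hM r 3 0 hr)
      (Ideal.mul_mem_right _ _ (hM s 1 0 hs))) (Ideal.mul_mem_right _ _ (hM t 2 0 ht)))
      (Ideal.mul_mem_right _ _ hc0)) hd0
  exact (N 0).2.1.ne_top ((Ideal.eq_top_iff_one _).2 h1)

theorem IsFinitelyStableDomain.finite_isMaximal_integralClosure (hR : IsFinitelyStableDomain R)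
    {a : R} (ha : InFinitelyManyMaximalIdeals a) :
    {N : Ideal (integralClosure R K) | N.IsMaximal ∧
      algebraMap R (integralClosure R K) a ∈ N}.Finite := by
  apply Set.Finite.of_finite_fibers (Ideal.comap (algebraMap R (integralClosure R K)))
  · refine ha.subset ?_
    rintro _ ⟨N, ⟨hN, haN⟩, rfl⟩
    exact ⟨Ideal.isMaximal_comap_of_isIntegral_of_isMaximal N, haN⟩
  · intro M _
    exact (hR.finite_isMaximal_comap_eq M).subset fun N hN => ⟨hN.1.1, hN.2⟩

/-- Divisibility by all powers of `a` descends from the integral closure of a finitely stable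
domain, up to squaring. -/
theorem IsFinitelyStableDomain.pow_dvd_sq (hR : IsFinitelyStableDomain R) {a b : R} {n : ℕ}
    (h : algebraMap R (integralClosure R K) a ^ n ∣ algebraMap R (integralClosure R K) b) :
    a ^ n ∣ b ^ 2 := by
  obtain ⟨c, hc⟩ := h
  obtain ⟨r, s, t, hrst⟩ := hR.mul_mem_of_isIntegral c.2 c.2
  -- With `b = a ^ n * c`, multiply `c² = r + (s + t) c` by `a ^ (2 * n)`.
  refine ⟨a ^ n * r + (s + t) * b, IsFractionRing.injective R K ?_⟩
  have hc' : algebraMap R K b = algebraMap R K a ^ n * c := congrArg Subtype.val hc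
  simp only [map_mul, map_add, map_pow]
  rw [hc']
  linear_combination (algebraMap R K a ^ n) ^ 2 * hrst

theorem exists_ne_zero_algebraMap_eq_mul {b : integralClosure R K} (hb : b ≠ 0) :
    ∃ x y : R, x ≠ 0 ∧ algebraMap R (integralClosure R K) x =
      algebraMap R (integralClosure R K) y * b := by
  obtain ⟨x, y, hy, hxy⟩ := IsFractionRing.div_surjective (A := R) (b : K)
  have hy0 : algebraMap R K y ≠ 0 := by simpa using nonZeroDivisors.ne_zero hy
  have h : algebraMap R (integralClosure R K) x = algebraMap R (integralClosure R K) y * b := by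
    apply Subtype.ext
    change algebraMap R K x = algebraMap R K y * (b : K)
    rw [← hxy]
    field_simp
  refine ⟨x, y, ?_, h⟩
  rintro rfl
  rw [map_zero, eq_comm, mul_eq_zero] at h
  refine h.elim (fun h => hy0 ?_) hb
  exact congrArg Subtype.val h

theorem IsFinitelyStableDomain.exists_isPrime_height_eq_one (hR : IsFinitelyStableDomain R)
    {a : R} (ha0 : a ≠ 0) (hfin : InFinitelyManyMaximalIdeals a)
    (h : ∀ b : R, (∀ n : ℕ, a ^ n ∣ b) → b = 0) :
    ∃ Q : Ideal (integralClosure R K),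
      Q.IsPrime ∧ Q.height = 1 ∧ algebraMap R (integralClosure R K) a ∈ Q := by
  by_contra! hcon
  have ha0' : algebraMap R (integralClosure R K) a ≠ 0 := fun h0 => ha0 <| by
    have : algebraMap R K a = 0 := congrArg Subtype.val h0
    simpa using this
  obtain ⟨b, hb0, hb⟩ := exists_ne_zero_forall_pow_dvd_of_finite
    (hR.finite_isMaximal_integralClosure (K := K) hfin) fun N hN haN =>
      have := hN.isPrime
      Ideal.exists_ne_zero_forall_pow_dvd hR.exists_notMem_dvd ha0' haN hcon
  obtain ⟨x, y, hx0, hxy⟩ := exists_ne_zero_algebraMap_eq_mul hb0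
  refine pow_ne_zero 2 hx0 (h _ fun n => hR.pow_dvd_sq (K := K) ?_)
  rw [hxy]
  exact (hb n).mul_left _

end IntegralClosure

/-! ### Archimedean localizations -/

section Archimedean

variable {R : Type*} [CommRing R]

theorem iInf_span_pow_eq_bot_iff {a : R} :
    (⨅ n : ℕ, Ideal.span {a ^ n}) = ⊥ ↔ ∀ b : R, (∀ n : ℕ, a ^ n ∣ b) → b = 0 := by
  simp [Submodule.eq_bot_iff, Submodule.mem_iInf, Ideal.mem_span_singleton]

theorem iInf_one_le_span_pow_eq {a : R} :
    (⨅ n : ℕ, ⨅ _ : 1 ≤ n, Ideal.span {a ^ n}) = ⨅ n : ℕ, Ideal.span {a ^ n} := by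
  refine le_antisymm (le_iInf fun n => ?_) (le_iInf₂ fun n _ => iInf_le _ n)
  refine (iInf₂_le (n + 1) (by omega)).trans ?_
  rw [Ideal.span_singleton_le_span_singleton]
  exact pow_dvd_pow a n.le_succ

variable [IsDomain R]

/-- Denominators outside `Q ∩ R` stay outside `Q`, so divisibility in the localization of `R` passes
to `D_Q`, where height one applies. -/
theorem isArchimedeanDomain_localization_comap {D : Type*} [CommRing D] [IsDomain D] [Algebra R D]
    [FaithfulSMul R D] {Q : Ideal D} [Q.IsPrime] (hQ : Q.height = 1) :
    IsArchimedeanDomain (Localization.AtPrime (Q.comap (algebraMap R D))) := by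
  set P := Q.comap (algebraMap R D) with hP
  intro r hr
  rw [iInf_span_pow_eq_bot_iff]
  intro b hb
  obtain ⟨r0, s0, rfl⟩ := IsLocalization.exists_mk'_eq P.primeCompl r
  obtain ⟨b0, t0, rfl⟩ := IsLocalization.exists_mk'_eq P.primeCompl b
  have hr0 : r0 ∈ P := by
    by_contra hr0
    exact hr ((IsLocalization.AtPrime.isUnit_mk'_iff _ P r0 s0).2 hr0)
  have hb0 : algebraMap R D b0 = 0 := by
    refine Ideal.eq_zero_of_forall_pow_dvd_of_height_eq_one hQ (r := algebraMap R D r0) hr0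
      fun n => ?_
    obtain ⟨c, hc⟩ := hb n
    obtain ⟨c0, u0, rfl⟩ := IsLocalization.exists_mk'_eq P.primeCompl c
    rw [← IsLocalization.mk'_pow, ← IsLocalization.mk'_mul, IsLocalization.mk'_eq_iff_eq] at hc
    have hc' := IsLocalization.injective (Localization.AtPrime P) P.primeCompl_le_nonZeroDivisors hc
    refine ⟨algebraMap R D ((s0 ^ n * u0 : P.primeCompl) : R), (s0 ^ n * u0).2, ?_⟩
    rw [← map_mul, ← map_pow]
    exact map_dvd _ ⟨t0 * c0, by linear_combination hc'⟩
  rw [(FaithfulSMul.algebraMap_eq_zero_iff R D).1 hb0]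
  exact IsLocalization.mk'_zero _

end Archimedean

/-! ### The main theorem -/

theorem mainTheorem6 (R : Type*) [CommRing R] [IsDomain R] :
    (IsFinitelyStableDomain R →
      ∀ a : R, a ≠ 0 → ¬ IsUnit a → InFinitelyManyMaximalIdeals a →
        List.TFAE
          [(⨅ n : ℕ, ⨅ _ : 1 ≤ n, Ideal.span {a ^ n}) = (⊥ : Ideal R),
            InHeightOnePrimeOfIntegralClosure a,
            ∃ (P : Ideal R) (_ : P.IsPrime),
              a ∈ P ∧ IsArchimedeanDomain (Localization.AtPrime P)]) ∧
    (IsFinitelyStableDomain R → HasFiniteCharacter R →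
      (IsArchimedeanDomain R ↔
        ∀ a : R, a ≠ 0 → ¬ IsUnit a → InHeightOnePrimeOfIntegralClosure a)) ∧
    (IsStableDomain R → IsFinitelyStableDomain R ∧ HasFiniteCharacter R) := by
  have h1 : IsFinitelyStableDomain R →
      ∀ a : R, a ≠ 0 → ¬ IsUnit a → InFinitelyManyMaximalIdeals a →
        List.TFAE
          [(⨅ n : ℕ, ⨅ _ : 1 ≤ n, Ideal.span {a ^ n}) = (⊥ : Ideal R),
            InHeightOnePrimeOfIntegralClosure a,
            ∃ (P : Ideal R) (_ : P.IsPrime),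
              a ∈ P ∧ IsArchimedeanDomain (Localization.AtPrime P)] := by
    intro hR a ha0 hau hfin
    rw [iInf_one_le_span_pow_eq, iInf_span_pow_eq_bot_iff]
    tfae_have 1 → 2 := fun h => hR.exists_isPrime_height_eq_one ha0 hfin h
    tfae_have 2 → 3 := by
      rintro ⟨Q, hQ, hQ1, haQ⟩
      exact ⟨Q.comap (algebraMap R _), inferInstance, haQ,
        isArchimedeanDomain_localization_comap hQ1⟩
    tfae_have 3 → 1 := by
      rintro ⟨P, hP, haP, hArch⟩ b hb
      have hu : ¬ IsUnit (algebraMap R (Localization.AtPrime P) a) := fun hu =>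
        (IsLocalization.AtPrime.isUnit_to_map_iff _ P a).1 hu haP
      have := iInf_span_pow_eq_bot_iff.1 (hArch _ hu) (algebraMap R _ b) fun n => by
        rw [← map_pow]
        exact map_dvd _ (hb n)
      exact (FaithfulSMul.algebraMap_eq_zero_iff R (Localization.AtPrime P)).1 this
    tfae_finish
  refine ⟨h1, fun hR hfc => ⟨fun h a ha0 hau => ?_, fun h a hau => ?_⟩, fun hR =>
    ⟨fun I _ h0 => hR I h0, hR.hasFiniteCharacter⟩⟩
  · refine ((h1 hR a ha0 hau (hfc a ha0)).out 0 1).1 ?_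
    rw [iInf_one_le_span_pow_eq]
    exact h a hau
  · by_cases ha0 : a = 0
    · rw [iInf_span_pow_eq_bot_iff]
      intro b hb
      -- Exponent `1` is needed because `0 ^ 0 = 1`.
      simpa [ha0] using hb 1
    · rw [← iInf_one_le_span_pow_eq]
      exact ((h1 hR a ha0 hau (hfc a ha0)).out 0 1).2 (h a ha0 hau)
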